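/- Let $(\mathcal R,\mu)$ be a $\sigma$-finite measure space, let $\mathcal M$ be the set of ($\mu$-a.e. equivalence classes of) extended complex-valued measurable functions, $\mathcal M_0\subseteq\mathcal M$ the functions finite a.e., and $\mathcal M_+\subseteq\mathcal M$ the functions with values in $[0,\infty]$. For $f\in\mathcal M$ let $f^*(t)=\inf\{s\in[0,\infty):\mu(\{|f|>s\})\le t\}$, $t\in[0,\infty)$ (with $\inf\emptyset=\infty$), be its non-increasing rearrangement; $f,g$ are equimeasurable if $f^*=g^*$, and $f\prec g$ means $\int_0^t f^*\,d\lambda\le\int_0^t g^*\,d\lambda$ for all $t\in(0,\infty)$. Assume that $(\mathcal R,\mu)$ is resonant, i.e. $\sup_{\tilde g^*=g^*}\int_{\mathcal R}|f\tilde g|\,d\mu=\int_0^\infty f^*g^*\,d\lambda$ for all $f,g\in\mathcal M$. A quasi-Banach function norm is a map $\|\cdot\|:\mathcal M\to[0,\infty]$ with $\|f\|=\||f|\|$ such that, for all functions in $\mathcal M_+$: $\|af\|=|a|\|f\|$ for $a\in\mathbb C$; $\|f\|=0$ iff $f=0$ a.e.; $\|f+g\|\le C(\|f\|+\|g\|)$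 for some constant $C\ge1$; $f\le g$ a.e. implies $\|f\|\le\|g\|$; $f_n\uparrow f$ a.e. implies $\|f_n\|\uparrow\|f\|$; and $\|\chi_E\|<\infty$ whenever $\mu(E)<\infty$. It is rearrangement-invariant (r.i.) if $\|f\|=\|g\|$ for equimeasurable $f,g$, and it satisfies (P5) if for every $E$ with $\mu(E)<\infty$ there is $C_E<\infty$ with $\int_E f\,d\mu\le C_E\|f\|$ for all $f\in\mathcal M_+$. Let $\|\cdot\|_X$ be an r.i. quasi-Banach function norm satisfying (P5), and let $X=\{f\in\mathcal M:\|f\|_X<\infty\}$. Let $\|f\|_{X'}=\sup_{g\in X}\|g\|_X^{-1}\int_{\mathcal R}|fg|\,d\mu$ (with $0/0=0$ and $a/0=\infty$ for $a>0$) be the associate functional, $X'=\{f\in\mathcal M:\|f\|_{X'}<\infty\}$ the associate space, and $\|\cdot\|_{X''}$ the associate functional of $\|\cdot\|_{X'}$. For $\varphi\in X'$ put $|f|_\varphi=\int_0^\infty\varphi^*f^*\,d\lambda$, and let $\xi$ be the locally convex topology on $X$ induced by the family $\{|\cdot|_\varphi:\varphi\in X'\}$. Then the following statements are equivalent: 1.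 $(X,\xi)$ is first-countable. 2. $(X,\xi)$ is metrizable. 3. $(X,\xi)$ is normable, i.e. $\xi$ is the topology of some norm on the vector space $X$. 4. There is $\psi\in X'$ such that $|\cdot|_\psi\approx\|\cdot\|_{X''}$ on $\mathcal M_0$, i.e. there is $C\in(0,\infty)$ with $|f|_\psi\le C\|f\|_{X''}$ and $\|f\|_{X''}\le C|f|_\psi$ for all $f\in\mathcal M_0$. 5. There is $\psi\in X'$ such that a function $\varphi\in\mathcal M_0$ belongs to $X'$ if and only if there is a constant $C_\varphi$ (finite, possibly depending on $\varphi$) with $\varphi\prec C_\varphi\psi$. -/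

import Mathlib

open MeasureTheory Filter Topology
open scoped ENNReal NNReal

namespace RIFunctionSpace

variable {R : Type*} [MeasurableSpace R] {μ : Measure R}

/-- The class of the modulus `|f|`, as a `[0,∞]`-valued function, of the class of an a.e. finite
complex-valued measurable function `f`. -/
noncomputable def modulus (f : R →ₘ[μ] ℂ) : R →ₘ[μ] ℝ≥0∞ :=
  AEEqFun.comp (fun z : ℂ => ‖z‖ₑ) continuous_enorm f

/-- The class of the characteristic function of a measurable set. -/
noncomputable def charFun (μ : Measure R) (E : Set R) (hE : MeasurableSet E) : R →ₘ[μ] ℝ≥0∞ :=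
  AEEqFun.mk (E.indicator fun _ => 1)
    ((measurable_const.indicator hE).aestronglyMeasurable)

/-- The product `a f` of a non-negative real number `a` and a `[0,∞]`-valued function `f`. -/
noncomputable def scale (a : ℝ≥0) (f : R →ₘ[μ] ℝ≥0∞) : R →ₘ[μ] ℝ≥0∞ :=
  AEEqFun.comp (fun y : ℝ≥0∞ => (a : ℝ≥0∞) * y)
    (ENNReal.continuous_const_mul ENNReal.coe_ne_top) f

/-- Distribution function `f_*(s) = μ {|f| > s}`. -/
noncomputable def distribution (f : R →ₘ[μ] ℝ≥0∞) (s : ℝ≥0) : ℝ≥0∞ :=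
  μ {x | (s : ℝ≥0∞) < f x}

/-- Non-increasing rearrangement `f^*(t) = inf {s ∈ [0,∞) : f_*(s) ≤ t}`, with `inf ∅ = ∞`.
Only the arguments `t ≥ 0` are meaningful. -/
noncomputable def rearrangement (f : R →ₘ[μ] ℝ≥0∞) (t : ℝ) : ℝ≥0∞ :=
  ⨅ (s : ℝ≥0) (_ : distribution f s ≤ ENNReal.ofReal t), (s : ℝ≥0∞)

/-- `f` and `g` are equimeasurable: `f^* = g^*` on `[0,∞)`. -/
def Equimeasurable (f g : R →ₘ[μ] ℝ≥0∞) : Prop :=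
  ∀ t : ℝ, 0 ≤ t → rearrangement f t = rearrangement g t

/-- The pairing `∫_0^∞ f^* g^* dλ`. -/
noncomputable def rearrPairing (f g : R →ₘ[μ] ℝ≥0∞) : ℝ≥0∞ :=
  ∫⁻ t in Set.Ioi (0 : ℝ), rearrangement f t * rearrangement g t

/-- The measure is resonant: the supremum of `∫ |f h| dμ` over all `h` equimeasurable with `g`
is equal to `∫_0^∞ f^* g^* dλ`, for all measurable `f`, `g`. -/
def Resonant (μ : Measure R) : Prop :=
  ∀ f g : R →ₘ[μ] ℝ≥0∞,
    (⨆ (h : R →ₘ[μ] ℝ≥0∞) (_ : Equimeasurable h g), ∫⁻ x, f x * h x ∂μ) = rearrPairing f g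

/-- Hardy--Littlewood--Pólya relation `f ≺ g`. -/
def HLP (f g : R →ₘ[μ] ℝ≥0∞) : Prop :=
  ∀ t : ℝ, 0 < t →
    ∫⁻ s in Set.Ioc 0 t, rearrangement f s ≤ ∫⁻ s in Set.Ioc 0 t, rearrangement g s

/-- Quasi-Banach function norms. Such a functional satisfies `‖f‖ = ‖ |f| ‖`, so that it is given by
its values on (classes of) non-negative, possibly infinite, measurable functions; its value at a
complex-valued `f` is `ρ (modulus f)`, and `‖a f‖` for `a ∈ ℂ`, `f ≥ 0` is `ρ (scale |a| f)`. -/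
structure IsQuasiBanachFunctionNorm (ρ : (R →ₘ[μ] ℝ≥0∞) → ℝ≥0∞) : Prop where
  smul : ∀ (a : ℝ≥0) (f : R →ₘ[μ] ℝ≥0∞), ρ (scale a f) = a * ρ f
  eq_zero_iff : ∀ f : R →ₘ[μ] ℝ≥0∞, ρ f = 0 ↔ f = 0
  quasi_add : ∃ C : ℝ≥0, 1 ≤ C ∧ ∀ f g : R →ₘ[μ] ℝ≥0∞, ρ (f + g) ≤ C * (ρ f + ρ g)
  mono : ∀ f g : R →ₘ[μ] ℝ≥0∞, f ≤ g → ρ f ≤ ρ g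
  fatou : ∀ (u : ℕ → R →ₘ[μ] ℝ≥0∞) (f : R →ₘ[μ] ℝ≥0∞), Monotone u →
    (∀ᵐ x ∂μ, Tendsto (fun n => u n x) atTop (𝓝 (f x))) →
    Tendsto (fun n => ρ (u n)) atTop (𝓝 (ρ f))
  charFun_lt_top : ∀ (E : Set R) (hE : MeasurableSet E), μ E < ∞ → ρ (charFun μ E hE) < ∞

/-- Property (P5): local embedding into `L^1`. -/
def HasP5 (ρ : (R →ₘ[μ] ℝ≥0∞) → ℝ≥0∞) : Prop :=
  ∀ E : Set R, MeasurableSet E → μ E < ∞ →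
    ∃ C : ℝ≥0, ∀ f : R →ₘ[μ] ℝ≥0∞, ∫⁻ x in E, f x ∂μ ≤ C * ρ f

/-- Rearrangement invariance. -/
def IsRearrangementInvariant (ρ : (R →ₘ[μ] ℝ≥0∞) → ℝ≥0∞) : Prop :=
  ∀ f g : R →ₘ[μ] ℝ≥0∞, Equimeasurable f g → ρ f = ρ g

/-- The associate functional `‖f‖_{X'} = sup_{g ∈ X} ‖g‖_X⁻¹ ∫ |f g| dμ`
(in `ℝ≥0∞`, `0 / 0 = 0` and `a / 0 = ∞` for `a > 0`). -/
noncomputable def associate (ρ : (R →ₘ[μ] ℝ≥0∞) → ℝ≥0∞) (f : R →ₘ[μ] ℝ≥0∞) : ℝ≥0∞ :=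
  ⨆ (g : R →ₘ[μ] ℝ≥0∞) (_ : ρ g < ∞), (∫⁻ x, f x * g x ∂μ) / ρ g

lemma modulus_zero : modulus (0 : R →ₘ[μ] ℂ) = 0 := by
  apply AEEqFun.ext
  filter_upwards [AEEqFun.coeFn_comp (fun z : ℂ => ‖z‖ₑ) continuous_enorm (0 : R →ₘ[μ] ℂ),
    AEEqFun.coeFn_zero (α := R) (β := ℂ) (μ := μ),
    AEEqFun.coeFn_zero (α := R) (β := ℝ≥0∞) (μ := μ)] with x h1 h2 h3
  rw [modulus, h1, h3]
  simp [h2]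

lemma modulus_add_le (f g : R →ₘ[μ] ℂ) : modulus (f + g) ≤ modulus f + modulus g := by
  rw [← AEEqFun.coeFn_le]
  filter_upwards [AEEqFun.coeFn_comp (fun z : ℂ => ‖z‖ₑ) continuous_enorm (f + g),
    AEEqFun.coeFn_comp (fun z : ℂ => ‖z‖ₑ) continuous_enorm f,
    AEEqFun.coeFn_comp (fun z : ℂ => ‖z‖ₑ) continuous_enorm g,
    AEEqFun.coeFn_add f g, AEEqFun.coeFn_add (modulus f) (modulus g)] with x h1 h2 h3 h4 h5
  rw [h5]
  simp only [modulus, Pi.add_apply, h1, h2, h3, Function.comp, h4]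
  exact enorm_add_le _ _

lemma modulus_smul (c : ℂ) (f : R →ₘ[μ] ℂ) : modulus (c • f) = scale ‖c‖₊ (modulus f) := by
  apply AEEqFun.ext
  filter_upwards [AEEqFun.coeFn_comp (fun z : ℂ => ‖z‖ₑ) continuous_enorm (c • f),
    AEEqFun.coeFn_comp (fun z : ℂ => ‖z‖ₑ) continuous_enorm f,
    AEEqFun.coeFn_smul c f, AEEqFun.coeFn_comp (fun y : ℝ≥0∞ => (‖c‖₊ : ℝ≥0∞) * y)
      (ENNReal.continuous_const_mul ENNReal.coe_ne_top) (modulus f)] with x h1 h2 h3 h4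
  rw [scale, h4]
  simp only [modulus, Pi.smul_apply, h1, h2, Function.comp, h3, enorm_smul]
  rfl

/-- The quasi-Banach function space `X = {f : ‖f‖_X < ∞}`, as a complex vector space. (A function
with `‖f‖_X < ∞` is automatically finite a.e.) -/
noncomputable def functionSpace {ρ : (R →ₘ[μ] ℝ≥0∞) → ℝ≥0∞}
    (hρ : IsQuasiBanachFunctionNorm ρ) : Submodule ℂ (R →ₘ[μ] ℂ) where
  carrier := {f | ρ (modulus f) < ∞}
  zero_mem' := by
    simp [modulus_zero, (hρ.eq_zero_iff 0).2 rfl]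
  add_mem' := by
    intro f g hf hg
    obtain ⟨C, -, hC⟩ := hρ.quasi_add
    refine lt_of_le_of_lt ((hρ.mono _ _ (modulus_add_le f g)).trans (hC _ _)) ?_
    exact ENNReal.mul_lt_top ENNReal.coe_lt_top (ENNReal.add_lt_top.2 ⟨hf, hg⟩)
  smul_mem' := by
    intro c f hf
    change ρ (modulus (c • f)) < ∞
    rw [modulus_smul, hρ.smul]
    exact ENNReal.mul_lt_top ENNReal.coe_lt_top hf

/-- The associate space `X'`. -/
def associateSpace (ρ : (R →ₘ[μ] ℝ≥0∞) → ℝ≥0∞) : Set (R →ₘ[μ] ℂ) :=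
  {φ | associate ρ (modulus φ) < ∞}

/-- The functional `|f|_φ = ∫_0^∞ φ^* f^* dλ`. -/
noncomputable def phiNorm (φ f : R →ₘ[μ] ℂ) : ℝ≥0∞ :=
  rearrPairing (modulus φ) (modulus f)

/-- The topology `ξ` on `X` induced by the family `|·|_φ`, `φ ∈ X'`: the one generated by
all the balls `{f ∈ X : |f - f₀|_φ < ε}`, `φ ∈ X'`, `f₀ ∈ X`, `ε > 0`. -/
abbrev xiTopology {ρ : (R →ₘ[μ] ℝ≥0∞) → ℝ≥0∞} (hρ : IsQuasiBanachFunctionNorm ρ) :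
    TopologicalSpace (functionSpace hρ) :=
  TopologicalSpace.generateFrom
    {B | ∃ φ ∈ associateSpace ρ, ∃ f₀ : functionSpace hρ, ∃ ε : ℝ≥0, 0 < ε ∧
      B = {f : functionSpace hρ | phiNorm φ ((f - f₀ : functionSpace hρ) : R →ₘ[μ] ℂ) < ε}}

/-- A topology on a complex vector space is normable if it is induced by a norm. -/
def IsNormable {E : Type*} [AddCommGroup E] [Module ℂ E] (τ : TopologicalSpace E) : Prop :=
  ∃ p : Seminorm ℂ E, (∀ f, p f = 0 → f = 0) ∧
    ∀ f₀ : E, (@nhds E τ f₀).HasBasis (fun ε : ℝ => 0 < ε) (fun ε => {f | p (f - f₀) < ε})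

end RIFunctionSpace

namespace RIFunctionSpace

variable {R : Type*} [MeasurableSpace R] {μ : Measure R}

/-! All five statements say that one `ψ ∈ X'` dominates: every `|·|_φ` with `φ ∈ X'` is at most a
constant times `|·|_ψ` on `X`. The topology `ξ` is then that of the single norm `|·|_ψ`, which is
equivalent to `‖·‖_{X''}`.

Resonance writes `∫ f^* g^*` as a supremum of integrals that are additive in `f`. This makes `|·|_φ`
a seminorm on `X` and gives the Hölder inequality `|f|_φ ≤ ‖φ‖_{X'} ‖f‖_{X''}`.

If `ξ` is first-countable, countably many `φ_n` describe the neighbourhoods of zero, and a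
convergent series `∑ c_n |φ_n|` in `X'` dominates (`exists_isDominating_of_firstCountable`). A
gliding-hump argument makes the domination constant proportional to `‖φ‖_{X'}`
(`IsDominating.exists_uniform`). Testing against all `φ ∈ X'` then yields `‖f‖_{X''} ≤ C |f|_ψ`,
first for truncations of `f` and then in the limit. Together with Hölder this is statement 4, which
makes `|·|_ψ` a norm inducing `ξ`.

Domination and `φ ≺ Cψ` are linked in both directions. Hardy's lemma turns `≺` into an inequality of
pairings (`HLP.rearrPairing_le`). Conversely, pairing with `χ_E` gives the inequality of integrals
over `(0, μ(E))`, and it extends to all `t` because rearrangements are constant across gaps in the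
range of `μ` (`HLP_of_rearrPairing_charFun_le`). -/

/-! ### Elementary properties of rearrangements and their pairing. -/

lemma rearrangement_antitone (f : R →ₘ[μ] ℝ≥0∞) : Antitone (rearrangement f) := by
  intro s t hst
  refine le_iInf₂ fun r hr => iInf₂_le r (hr.trans (ENNReal.ofReal_le_ofReal hst))

lemma measurable_rearrangement (f : R →ₘ[μ] ℝ≥0∞) : Measurable (rearrangement f) :=
  (rearrangement_antitone f).measurable

lemma rearrangement_zero (t : ℝ) : rearrangement (0 : R →ₘ[μ] ℝ≥0∞) t = 0 := by
  have h : distribution (0 : R →ₘ[μ] ℝ≥0∞) 0 = 0 := by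
    refine measure_eq_zero_iff_ae_notMem.2 ?_
    filter_upwards [AEEqFun.coeFn_zero (α := R) (β := ℝ≥0∞) (μ := μ)] with x hx
    simp [hx]
  have h' : rearrangement (0 : R →ₘ[μ] ℝ≥0∞) t ≤ ((0 : ℝ≥0) : ℝ≥0∞) :=
    iInf₂_le (0 : ℝ≥0) (by rw [h]; exact zero_le)
  simpa using h'

lemma rearrPairing_comm (f g : R →ₘ[μ] ℝ≥0∞) : rearrPairing f g = rearrPairing g f := by
  simp only [rearrPairing, mul_comm]

lemma rearrPairing_zero_left (f : R →ₘ[μ] ℝ≥0∞) : rearrPairing 0 f = 0 := by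
  simp [rearrPairing, rearrangement_zero]

lemma rearrPairing_zero_right (f : R →ₘ[μ] ℝ≥0∞) : rearrPairing f 0 = 0 := by
  rw [rearrPairing_comm, rearrPairing_zero_left]

lemma rearrPairing_congr_left {f g : R →ₘ[μ] ℝ≥0∞} (h : Equimeasurable f g)
    (k : R →ₘ[μ] ℝ≥0∞) : rearrPairing f k = rearrPairing g k := by
  refine setLIntegral_congr_fun measurableSet_Ioi fun t ht => ?_
  simp only [h t (le_of_lt ht)]

lemma measurable_coeFn_mul (f g : R →ₘ[μ] ℝ≥0∞) : Measurable fun x => f x * g x :=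
  f.measurable.mul g.measurable

lemma lintegral_add_mul (f g k : R →ₘ[μ] ℝ≥0∞) :
    ∫⁻ x, (f + g : R →ₘ[μ] ℝ≥0∞) x * k x ∂μ = ∫⁻ x, f x * k x ∂μ + ∫⁻ x, g x * k x ∂μ := by
  rw [← lintegral_add_left (measurable_coeFn_mul f k)]
  refine lintegral_congr_ae ?_
  filter_upwards [AEEqFun.coeFn_add f g] with x hx
  rw [hx, Pi.add_apply, add_mul]

/-! ### Consequences of resonance -/

lemma Resonant.lintegral_mul_le (hμ : Resonant μ) (f g : R →ₘ[μ] ℝ≥0∞) :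
    ∫⁻ x, f x * g x ∂μ ≤ rearrPairing f g := by
  rw [← hμ f g]
  exact le_iSup₂_of_le g (fun _ _ => rfl) le_rfl

lemma Resonant.lintegral_mul_le_of_equimeasurable (hμ : Resonant μ) {f g h : R →ₘ[μ] ℝ≥0∞}
    (hh : Equimeasurable h g) : ∫⁻ x, f x * h x ∂μ ≤ rearrPairing f g := by
  rw [← hμ f g]
  exact le_iSup₂_of_le h hh le_rfl

lemma Resonant.rearrPairing_le (hμ : Resonant μ) {f g : R →ₘ[μ] ℝ≥0∞} {c : ℝ≥0∞}
    (h : ∀ k, Equimeasurable k g → ∫⁻ x, f x * k x ∂μ ≤ c) : rearrPairing f g ≤ c := by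
  rw [← hμ f g]
  exact iSup₂_le h

lemma Resonant.rearrPairing_mono_left (hμ : Resonant μ) {f₁ f₂ : R →ₘ[μ] ℝ≥0∞} (h : f₁ ≤ f₂)
    (g : R →ₘ[μ] ℝ≥0∞) : rearrPairing f₁ g ≤ rearrPairing f₂ g := by
  refine hμ.rearrPairing_le fun k hk =>
    (lintegral_mono_ae ?_).trans (hμ.lintegral_mul_le_of_equimeasurable hk)
  filter_upwards [AEEqFun.coeFn_le.2 h] with x hx
  gcongr

lemma Resonant.rearrPairing_mono_right (hμ : Resonant μ) (f : R →ₘ[μ] ℝ≥0∞)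
    {g₁ g₂ : R →ₘ[μ] ℝ≥0∞} (h : g₁ ≤ g₂) : rearrPairing f g₁ ≤ rearrPairing f g₂ := by
  rw [rearrPairing_comm f, rearrPairing_comm f]
  exact hμ.rearrPairing_mono_left h f

/-- The pointwise inequality `(f₁ + f₂)^* ≤ f₁^* + f₂^*` fails in general; subadditivity comes from
resonance, since each `∫ (f₁ + f₂) k` splits. -/
lemma Resonant.rearrPairing_add_le (hμ : Resonant μ) (f₁ f₂ g : R →ₘ[μ] ℝ≥0∞) :
    rearrPairing (f₁ + f₂) g ≤ rearrPairing f₁ g + rearrPairing f₂ g := by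
  refine hμ.rearrPairing_le fun k hk => ?_
  rw [lintegral_add_mul]
  exact add_le_add (hμ.lintegral_mul_le_of_equimeasurable hk)
    (hμ.lintegral_mul_le_of_equimeasurable hk)

lemma coeFn_scale (a : ℝ≥0) (f : R →ₘ[μ] ℝ≥0∞) : ∀ᵐ x ∂μ, scale a f x = a * f x :=
  AEEqFun.coeFn_comp _ _ f

lemma lintegral_scale_mul (a : ℝ≥0) (f k : R →ₘ[μ] ℝ≥0∞) :
    ∫⁻ x, scale a f x * k x ∂μ = a * ∫⁻ x, f x * k x ∂μ := by
  rw [← lintegral_const_mul _ (measurable_coeFn_mul f k)]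
  refine lintegral_congr_ae ?_
  filter_upwards [coeFn_scale a f] with x hx
  rw [hx, mul_assoc]

lemma Resonant.rearrPairing_scale_left (hμ : Resonant μ) (a : ℝ≥0) (f g : R →ₘ[μ] ℝ≥0∞) :
    rearrPairing (scale a f) g = a * rearrPairing f g := by
  rw [← hμ, ← hμ]
  simp only [lintegral_scale_mul, ENNReal.mul_iSup]

lemma Resonant.rearrPairing_scale_right (hμ : Resonant μ) (a : ℝ≥0) (f g : R →ₘ[μ] ℝ≥0∞) :
    rearrPairing f (scale a g) = a * rearrPairing f g := by
  rw [rearrPairing_comm, hμ.rearrPairing_scale_left, rearrPairing_comm]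

/-! ### Associate functionals -/

lemma lintegral_mul_eq_zero_of_eq_zero (f : R →ₘ[μ] ℝ≥0∞) :
    ∫⁻ x, f x * (0 : R →ₘ[μ] ℝ≥0∞) x ∂μ = 0 := by
  rw [lintegral_eq_zero_iff' (measurable_coeFn_mul f 0).aemeasurable]
  filter_upwards [AEEqFun.coeFn_zero (α := R) (β := ℝ≥0∞) (μ := μ)] with x hx
  simp [hx]

section Associate

variable {ρ : (R →ₘ[μ] ℝ≥0∞) → ℝ≥0∞}

/-- Definiteness removes the quotient: `ρ g = 0` forces `g = 0`, where the integral vanishes too.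
Only definiteness is assumed of `ρ`, so that the results also apply to `associate ρ` and hence to
`X''`. -/
lemma associate_le_iff (hd : ∀ g, ρ g = 0 → g = 0) {f : R →ₘ[μ] ℝ≥0∞} {c : ℝ≥0∞} :
    associate ρ f ≤ c ↔ ∀ g, ρ g < ∞ → ∫⁻ x, f x * g x ∂μ ≤ c * ρ g := by
  rw [associate, iSup₂_le_iff]
  refine forall₂_congr fun g hg => ?_
  by_cases h0 : ρ g = 0
  · obtain rfl := hd g h0
    simp [h0, lintegral_mul_eq_zero_of_eq_zero]
  · rw [ENNReal.div_le_iff h0 hg.ne]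

lemma lintegral_mul_le_associate (hd : ∀ g, ρ g = 0 → g = 0) (f : R →ₘ[μ] ℝ≥0∞)
    {g : R →ₘ[μ] ℝ≥0∞} (hg : ρ g < ∞) : ∫⁻ x, f x * g x ∂μ ≤ associate ρ f * ρ g :=
  (associate_le_iff hd).1 le_rfl g hg

/-- Hölder's inequality for rearrangements: the ordinary bound for `∫ f k` is the same for all `k`
equimeasurable with `g`, so it survives the supremum in resonance. -/
lemma rearrPairing_le_associate (hμ : Resonant μ) (hd : ∀ g, ρ g = 0 → g = 0)
    (hri : IsRearrangementInvariant ρ) (f : R →ₘ[μ] ℝ≥0∞) {g : R →ₘ[μ] ℝ≥0∞} (hg : ρ g < ∞) :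
    rearrPairing f g ≤ associate ρ f * ρ g := by
  refine hμ.rearrPairing_le fun k hk => ?_
  rw [← hri k g hk] at hg ⊢
  exact lintegral_mul_le_associate hd f hg

lemma associate_le_of_rearrPairing_le (hμ : Resonant μ) (hd : ∀ g, ρ g = 0 → g = 0)
    {f : R →ₘ[μ] ℝ≥0∞} {c : ℝ≥0∞} (h : ∀ g, ρ g < ∞ → rearrPairing f g ≤ c * ρ g) :
    associate ρ f ≤ c :=
  (associate_le_iff hd).2 fun g hg => (hμ.lintegral_mul_le f g).trans (h g hg)

lemma isRearrangementInvariant_associate (hμ : Resonant μ) (hd : ∀ g, ρ g = 0 → g = 0)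
    (hri : IsRearrangementInvariant ρ) : IsRearrangementInvariant (associate ρ) := by
  have key : ∀ f g : R →ₘ[μ] ℝ≥0∞, Equimeasurable f g → associate ρ f ≤ associate ρ g := by
    intro f g hfg
    refine associate_le_of_rearrPairing_le hμ hd fun k hk => ?_
    rw [rearrPairing_congr_left hfg]
    exact rearrPairing_le_associate hμ hd hri g hk
  exact fun f g hfg => le_antisymm (key f g hfg) (key g f fun t ht => (hfg t ht).symm)

lemma associate_zero (hd : ∀ g, ρ g = 0 → g = 0) : associate ρ 0 = 0 := by
  refine le_antisymm ((associate_le_iff hd).2 fun g _ => ?_) zero_le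
  simp only [mul_comm _ (g _)]
  simp [lintegral_mul_eq_zero_of_eq_zero]

lemma associate_add_le (hd : ∀ g, ρ g = 0 → g = 0) (f g : R →ₘ[μ] ℝ≥0∞) :
    associate ρ (f + g) ≤ associate ρ f + associate ρ g := by
  refine (associate_le_iff hd).2 fun k hk => ?_
  rw [lintegral_add_mul, add_mul]
  exact add_le_add (lintegral_mul_le_associate hd f hk) (lintegral_mul_le_associate hd g hk)

/-- Weighted series in the associate space. -/
lemma exists_associate_lt_top_of_tsum (hd : ∀ g, ρ g = 0 → g = 0) (φ : ℕ → R →ₘ[μ] ℝ≥0∞)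
    (c : ℕ → ℝ≥0) (h : ∑' n, (c n : ℝ≥0∞) * associate ρ (φ n) < ∞) :
    ∃ ψ : R →ₘ[μ] ℝ≥0∞, associate ρ ψ < ∞ ∧ ∀ n, scale (c n) (φ n) ≤ ψ := by
  have hm : Measurable fun x => ∑' n, (c n : ℝ≥0∞) * φ n x :=
    Measurable.tsum fun n => (φ n).measurable.const_mul _
  refine ⟨AEEqFun.mk _ hm.aestronglyMeasurable, lt_of_le_of_lt ?_ h, fun n => ?_⟩
  · refine (associate_le_iff hd).2 fun g hg => ?_
    have e : ∫⁻ x, (AEEqFun.mk _ hm.aestronglyMeasurable : R →ₘ[μ] ℝ≥0∞) x * g x ∂μ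
        = ∑' n, (c n : ℝ≥0∞) * ∫⁻ x, φ n x * g x ∂μ := by
      have e1 : ∀ n, (c n : ℝ≥0∞) * ∫⁻ x, φ n x * g x ∂μ
          = ∫⁻ x, (c n : ℝ≥0∞) * (φ n x * g x) ∂μ := fun n =>
        (lintegral_const_mul _ (measurable_coeFn_mul (φ n) g)).symm
      simp_rw [e1]
      rw [← lintegral_tsum fun n =>
        ((measurable_coeFn_mul (φ n) g).const_mul _).aemeasurable]
      refine lintegral_congr_ae ?_
      filter_upwards [AEEqFun.coeFn_mk _ (hm.aestronglyMeasurable (μ := μ))] with x hx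
      rw [hx, ← ENNReal.tsum_mul_right]
      simp only [mul_assoc]
    rw [e, ← ENNReal.tsum_mul_right]
    refine ENNReal.tsum_le_tsum fun n => ?_
    rw [mul_assoc]
    gcongr
    exact lintegral_mul_le_associate hd _ hg
  · rw [← AEEqFun.coeFn_le]
    filter_upwards [AEEqFun.coeFn_mk _ (hm.aestronglyMeasurable (μ := μ)),
      coeFn_scale (c n) (φ n)] with x hx hx'
    rw [hx, hx']
    exact ENNReal.le_tsum n

end Associate

/-! ### Hardy's lemma -/

/-- Such a set is `(0, m]` if it has a maximum `m`, and otherwise the directed union of `(0, q]`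
over its rational points; continuity from below needs no finiteness. -/
lemma measure_le_of_isLowerSet_Ioi {ν₁ ν₂ : Measure ℝ}
    (h : ∀ t : ℝ, 0 < t → ν₁ (Set.Ioc 0 t) ≤ ν₂ (Set.Ioc 0 t)) {S : Set ℝ}
    (hS : ∀ t ∈ S, ∀ s, 0 < s → s ≤ t → s ∈ S) (hpos : S ⊆ Set.Ioi 0) : ν₁ S ≤ ν₂ S := by
  by_cases hmax : ∃ m ∈ S, ∀ t ∈ S, t ≤ m
  · obtain ⟨m, hm, hle⟩ := hmax
    have e : S = Set.Ioc 0 m :=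
      Set.Subset.antisymm (fun t ht => ⟨hpos ht, hle t ht⟩) fun t ht => hS m hm t ht.1 ht.2
    rw [e]
    exact h m (hpos hm)
  · push Not at hmax
    have e : S = ⋃ q : {q : ℚ // (q : ℝ) ∈ S}, Set.Ioc 0 (q.1 : ℝ) := by
      ext t
      simp only [Set.mem_iUnion, Set.mem_Ioc]
      constructor
      · intro ht
        obtain ⟨t', ht', hlt⟩ := hmax t ht
        obtain ⟨q, hq1, hq2⟩ := exists_rat_btwn hlt
        exact ⟨⟨q, hS t' ht' q ((hpos ht).trans hq1) hq2.le⟩, hpos ht, hq1.le⟩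
      · rintro ⟨q, h0, hq⟩
        exact hS _ q.2 t h0 hq
    have hdir : Directed (· ⊆ ·) fun q : {q : ℚ // (q : ℝ) ∈ S} => Set.Ioc (0 : ℝ) (q.1 : ℝ) :=
      Monotone.directed_le fun p q hpq =>
        Set.Ioc_subset_Ioc_right (by exact_mod_cast hpq)
    rw [e, hdir.measure_iUnion, hdir.measure_iUnion]
    exact iSup_mono fun q => h _ (hpos q.2)

/-- Layer-cake formula: superlevel sets of an antitone weight are lower sets, where the measures are
already compared. Truncating at `n` makes the weight real-valued for that formula. -/
lemma lintegral_le_of_antitone {ν₁ ν₂ : Measure ℝ}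
    (h : ∀ t : ℝ, 0 < t → ν₁ (Set.Ioc 0 t) ≤ ν₂ (Set.Ioc 0 t)) {w : ℝ → ℝ≥0∞}
    (hw : Antitone w) :
    ∫⁻ t in Set.Ioi 0, w t ∂ν₁ ≤ ∫⁻ t in Set.Ioi 0, w t ∂ν₂ := by
  have key : ∀ n : ℕ, ∀ ν : Measure ℝ, ∫⁻ t in Set.Ioi 0, min (w t) n ∂ν
      = ∫⁻ s in Set.Ioi (0 : ℝ), ν ({t | s < (min (w t) n).toReal} ∩ Set.Ioi 0) := by
    intro n ν
    have hm : Measurable fun t => (min (w t) n).toReal :=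
      (hw.measurable.min measurable_const).ennreal_toReal
    have := lintegral_eq_lintegral_meas_lt (ν.restrict (Set.Ioi 0))
      (f := fun t => (min (w t) n).toReal) (ae_of_all _ fun t => ENNReal.toReal_nonneg)
      hm.aemeasurable
    simp only [Measure.restrict_apply (measurableSet_lt measurable_const hm)] at this
    rw [← this]
    refine lintegral_congr fun t => ?_
    rw [ENNReal.ofReal_toReal]
    exact ((min_le_right _ _).trans_lt (ENNReal.natCast_lt_top n)).ne
  have hsup : ∀ ν : Measure ℝ, ∫⁻ t in Set.Ioi 0, w t ∂ν
      = ⨆ n : ℕ, ∫⁻ t in Set.Ioi 0, min (w t) n ∂ν := by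
    intro ν
    rw [← lintegral_iSup (fun n => hw.measurable.min measurable_const)]
    · refine lintegral_congr fun t => ?_
      simp only [min_comm (w t)]
      rw [← iSup_inf_eq, ENNReal.iSup_natCast, top_inf_eq]
    · intro m n hmn t
      exact min_le_min_left _ (by exact_mod_cast hmn)
  rw [hsup, hsup]
  refine iSup_mono fun n => ?_
  rw [key, key]
  refine lintegral_mono fun s => measure_le_of_isLowerSet_Ioi h ?_ Set.inter_subset_right
  rintro t ⟨ht, -⟩ r hr hrt
  refine ⟨lt_of_lt_of_le ht (ENNReal.toReal_mono ?_ (min_le_min_right _ (hw hrt))), hr⟩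
  exact ((min_le_right _ _).trans_lt (ENNReal.natCast_lt_top n)).ne

/-- Hardy's lemma for the measures with densities `f^*` and `g^*` and the weight `k^*`. -/
lemma HLP.rearrPairing_le {f g : R →ₘ[μ] ℝ≥0∞} (h : HLP f g) (k : R →ₘ[μ] ℝ≥0∞) :
    rearrPairing f k ≤ rearrPairing g k := by
  have e : ∀ f : R →ₘ[μ] ℝ≥0∞, rearrPairing f k
      = ∫⁻ t in Set.Ioi 0, rearrangement k t ∂(volume.withDensity (rearrangement f)) := by
    intro f
    rw [restrict_withDensity measurableSet_Ioi,
      lintegral_withDensity_eq_lintegral_mul _ (measurable_rearrangement f)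
        (measurable_rearrangement k)]
    rfl
  rw [e, e]
  refine lintegral_le_of_antitone (fun t ht => ?_) (rearrangement_antitone k)
  rw [withDensity_apply _ measurableSet_Ioc, withDensity_apply _ measurableSet_Ioc]
  exact h t ht

/-! ### Characteristic functions -/

lemma rearrangement_charFun {E : Set R} (hE : MeasurableSet E) (hfin : μ E < ∞) {t : ℝ}
    (ht : 0 ≤ t) : rearrangement (charFun μ E hE) t
      = (Set.Iio (μ E).toReal).indicator (fun _ => 1) t := by
  have hae : ∀ᵐ x ∂μ, charFun μ E hE x = E.indicator (fun _ => 1) x := AEEqFun.coeFn_mk _ _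
  have hd : ∀ s : ℝ≥0, s < 1 → distribution (charFun μ E hE) s = μ E := by
    intro s hs
    refine measure_congr ?_
    filter_upwards [hae] with x hx
    apply propext
    change (s : ℝ≥0∞) < charFun μ E hE x ↔ x ∈ E
    rw [hx]
    by_cases hxE : x ∈ E <;> simp [hxE, hs]
  have hd1 : distribution (charFun μ E hE) 1 = 0 := by
    refine measure_eq_zero_iff_ae_notMem.2 ?_
    filter_upwards [hae] with x hx
    rw [hx]
    by_cases hxE : x ∈ E <;> simp [hxE]
  by_cases h : t < (μ E).toReal
  · rw [Set.indicator_of_mem (by exact h)]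
    refine le_antisymm ?_ (le_iInf₂ fun s hs => ?_)
    · exact (iInf₂_le (1 : ℝ≥0) (by rw [hd1]; exact zero_le)).trans (by simp)
    · by_contra! hlt
      rw [hd s (by exact_mod_cast hlt)] at hs
      exact absurd (ENNReal.toReal_le_of_le_ofReal ht hs) (not_le.2 h)
  · rw [Set.indicator_of_notMem (by exact h)]
    refine le_antisymm ((iInf₂_le (0 : ℝ≥0) ?_).trans (by simp)) zero_le
    rw [hd 0 zero_lt_one]
    exact (ENNReal.le_ofReal_iff_toReal_le hfin.ne ht).2 (not_lt.1 h)

lemma rearrPairing_charFun (φ : R →ₘ[μ] ℝ≥0∞) {E : Set R} (hE : MeasurableSet E)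
    (hfin : μ E < ∞) : rearrPairing φ (charFun μ E hE)
      = ∫⁻ t in Set.Ioc 0 (μ E).toReal, rearrangement φ t := by
  have : rearrPairing φ (charFun μ E hE) = ∫⁻ t in Set.Ioi 0,
      (Set.Iio (μ E).toReal).indicator (rearrangement φ) t := by
    refine setLIntegral_congr_fun measurableSet_Ioi fun t ht => ?_
    simp only [rearrangement_charFun hE hfin (le_of_lt ht)]
    by_cases h : t ∈ Set.Iio (μ E).toReal <;> simp [h]
  rw [this, setLIntegral_indicator measurableSet_Iio, Set.Iio_inter_Ioi]
  exact setLIntegral_congr Ioo_ae_eq_Ioc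

/-- Distribution functions take only values of `μ`, so they cannot tell apart two thresholds with no
such value between them. -/
lemma rearrangement_eq_of_gap (φ : R →ₘ[μ] ℝ≥0∞) {s t : ℝ} (hst : s ≤ t)
    (h : ∀ E, MeasurableSet E → μ E ≤ ENNReal.ofReal t → μ E ≤ ENNReal.ofReal s) :
    rearrangement φ s = rearrangement φ t := by
  refine le_antisymm (le_iInf₂ fun r hr => iInf₂_le r (h _ ?_ hr)) (rearrangement_antitone φ hst)
  exact measurableSet_lt measurable_const φ.measurable

lemma setLIntegral_rearrangement_le_univ (φ : R →ₘ[μ] ℝ≥0∞) (hfin : μ Set.univ < ∞) (t : ℝ) :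
    ∫⁻ s in Set.Ioc 0 t, rearrangement φ s
      ≤ ∫⁻ s in Set.Ioc 0 (μ Set.univ).toReal, rearrangement φ s := by
  have h : ∫⁻ s in Set.Ioc 0 t, rearrangement φ s
      = ∫⁻ s in Set.Ioc 0 t, (Set.Iic (μ Set.univ).toReal).indicator (rearrangement φ) s := by
    refine setLIntegral_congr_fun measurableSet_Ioc fun s hs => ?_
    by_cases hm : s ∈ Set.Iic (μ Set.univ).toReal
    · rw [Set.indicator_of_mem hm]
    · rw [Set.indicator_of_notMem hm]
      refine le_antisymm ((iInf₂_le (0 : ℝ≥0) ?_).trans (by simp)) zero_le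
      refine (measure_mono (Set.subset_univ _)).trans ?_
      exact (ENNReal.le_ofReal_iff_toReal_le hfin.ne hs.1.le).2 (not_le.1 hm).le
  rw [h, setLIntegral_indicator measurableSet_Iic]
  exact lintegral_mono_set fun s hs => ⟨hs.2.1, hs.1⟩

lemma setLIntegral_antitone_eq {w : ℝ → ℝ≥0∞} (hw : Antitone w) {v : ℝ} (h0 : 0 ≤ v)
    (hfin : ∫⁻ s in Set.Ioc 0 v, w s < ∞) :
    IntervalIntegrable (fun s => (w s).toReal) volume 0 v ∧ ∀ t ∈ Set.Icc 0 v,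
      ∫⁻ s in Set.Ioc 0 t, w s = ENNReal.ofReal (∫ s in (0 : ℝ)..t, (w s).toReal) := by
  have hsub : ∀ t ∈ Set.Icc 0 v, ∫⁻ s in Set.Ioc 0 t, w s ≠ ∞ := fun t ht =>
    ((lintegral_mono_set (Set.Ioc_subset_Ioc_right ht.2)).trans_lt hfin).ne
  refine ⟨?_, fun t ht => ?_⟩
  · rw [intervalIntegrable_iff_integrableOn_Ioc_of_le h0]
    exact integrable_toReal_of_lintegral_ne_top hw.measurable.aemeasurable hfin.ne
  · rw [intervalIntegral.integral_of_le ht.1, integral_toReal hw.measurable.aemeasurable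
      (ae_lt_top hw.measurable (hsub t ht)), ENNReal.ofReal_toReal (hsub t ht)]

/-- If the integral inequality holds at all values of the measure, it holds everywhere, because
both sides are affine between such values. -/
lemma integral_le_of_affine_gaps {u w : ℝ → ℝ} {v t : ℝ} (ht : t ∈ Set.Icc 0 v)
    (hu : IntervalIntegrable u volume 0 v) (hw : IntervalIntegrable w volume 0 v) (V : Set ℝ)
    (hgap : ∀ a b, 0 ≤ a → (∀ s ∈ Set.Ioo a b, s ∉ V) → ∀ r ∈ Set.Ioo a b, ∀ s ∈ Set.Ioo a b,
      u r = u s ∧ w r = w s)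
    (hV : ∀ r ∈ V, r ∈ Set.Icc 0 v → ∫ s in (0 : ℝ)..r, u s ≤ ∫ s in (0 : ℝ)..r, w s)
    (hv : v ∈ V) : ∫ s in (0 : ℝ)..t, u s ≤ ∫ s in (0 : ℝ)..t, w s := by
  have h0v : 0 ≤ v := ht.1.trans ht.2
  have hcont : ∀ {g : ℝ → ℝ}, IntervalIntegrable g volume 0 v →
      ContinuousOn (fun r => ∫ s in (0 : ℝ)..r, g s) (Set.Icc 0 v) := by
    intro g hg
    have := intervalIntegral.continuousOn_primitive_interval' hg Set.left_mem_uIcc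
    rwa [Set.uIcc_of_le h0v] at this
  set A : Set ℝ := {r ∈ Set.Icc 0 v | ∫ s in (0 : ℝ)..r, u s ≤ ∫ s in (0 : ℝ)..r, w s} with hA
  have hAc : IsClosed A := isClosed_Icc.isClosed_le (hcont hu) (hcont hw)
  by_contra! hlt
  have htA : t ∉ A := fun h => absurd h.2 (not_le.2 hlt)
  have h0A : (0 : ℝ) ∈ A := ⟨⟨le_rfl, h0v⟩, by simp⟩
  have hvA : v ∈ A := ⟨⟨h0v, le_rfl⟩, hV v hv ⟨h0v, le_rfl⟩⟩
  have hcl : IsCompact (A ∩ Set.Icc 0 t) := isCompact_Icc.inter_left hAc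
  have hcr : IsCompact (A ∩ Set.Icc t v) := isCompact_Icc.inter_left hAc
  -- `a` and `b` are the points of `A` nearest to `t` on either side. Points of `V` in `[0, v]` lie
  -- in `A`, so `(a, b)` is a gap of `V`.
  obtain ⟨a, ha, hamax⟩ := hcl.exists_isGreatest ⟨0, h0A, le_rfl, ht.1⟩
  obtain ⟨b, hb, hbmin⟩ := hcr.exists_isLeast ⟨v, hvA, ht.2, le_rfl⟩
  have hat : a < t := lt_of_le_of_ne ha.2.2 fun h => htA (h ▸ ha.1)
  have htb : t < b := lt_of_le_of_ne hb.2.1 fun h => htA (h ▸ hb.1)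
  have hnot : ∀ s ∈ Set.Ioo a b, s ∉ V := by
    intro s hs hsV
    have hs0 : 0 ≤ s := ha.2.1.trans hs.1.le
    have hsv : s ≤ v := hs.2.le.trans hb.2.2
    have hsA : s ∈ A := ⟨⟨hs0, hsv⟩, hV s hsV ⟨hs0, hsv⟩⟩
    rcases le_total s t with h | h
    · exact absurd (hamax ⟨hsA, hs0, h⟩) (not_le.2 hs.1)
    · exact absurd (hbmin ⟨hsA, h, hsv⟩) (not_le.2 hs.2)
  have hconst := hgap a b ha.2.1 hnot
  have haff : ∀ {g : ℝ → ℝ}, IntervalIntegrable g volume 0 v →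
      (∀ s ∈ Set.Ioo a b, g s = g t) → ∀ r ∈ Set.Icc a b,
      ∫ s in (0 : ℝ)..r, g s = (∫ s in (0 : ℝ)..a, g s) + (r - a) * g t := by
    intro g hg hc r hr
    have hsub : ∀ x ∈ Set.Icc 0 v, ∀ y ∈ Set.Icc 0 v, IntervalIntegrable g volume x y := by
      intro x hx y hy
      refine hg.mono_set ?_
      rw [Set.uIcc_of_le h0v]
      exact Set.uIcc_subset_Icc hx hy
    have ha' : a ∈ Set.Icc 0 v := ⟨ha.2.1, hat.le.trans ht.2⟩
    have hr' : r ∈ Set.Icc 0 v := ⟨ha.2.1.trans hr.1, hr.2.trans hb.2.2⟩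
    rw [← intervalIntegral.integral_add_adjacent_intervals
      (hsub 0 ⟨le_rfl, h0v⟩ a ha') (hsub a ha' r hr')]
    congr 1
    rw [← smul_eq_mul, ← intervalIntegral.integral_const]
    rw [intervalIntegral.integral_of_le hr.1, intervalIntegral.integral_of_le hr.1,
      integral_Ioc_eq_integral_Ioo, integral_Ioc_eq_integral_Ioo]
    exact setIntegral_congr_fun measurableSet_Ioo fun s hs => hc s ⟨hs.1, hs.2.trans_le hr.2⟩
  have hab : a ≤ b := (hat.trans htb).le
  have htab : t ∈ Set.Ioo a b := ⟨hat, htb⟩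
  have hcu := haff hu fun s hs => (hconst s hs t htab).1
  have hcw := haff hw fun s hs => (hconst s hs t htab).2
  have h1 := ha.1.2
  have h2 := hb.1.2
  rw [hcu b ⟨hab, le_rfl⟩, hcw b ⟨hab, le_rfl⟩] at h2
  rw [hcu t ⟨hat.le, htb.le⟩, hcw t ⟨hat.le, htb.le⟩] at hlt
  -- Both primitives are affine on `[a, b]`; the inequality at the two endpoints therefore passes to
  -- `t`, against `hlt`.
  nlinarith [mul_pos (sub_pos.2 hat) (sub_pos.2 htb), sub_pos.2 hat, sub_pos.2 htb]

/-- Pairing with `χ_E` integrates the rearrangement up to `μ(E)`. Finiteness of these pairings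
allows the passage to real integrals, where the gap argument applies. -/
lemma HLP_of_rearrPairing_charFun_le [SigmaFinite μ] {f g : R →ₘ[μ] ℝ≥0∞}
    (hfin : ∀ E hE, μ E < ∞ → rearrPairing g (charFun μ E hE) < ∞)
    (h : ∀ E hE, μ E < ∞ → rearrPairing f (charFun μ E hE) ≤ rearrPairing g (charFun μ E hE)) :
    HLP f g := by
  have hF : ∀ E, MeasurableSet E → μ E < ∞ →
      ∫⁻ s in Set.Ioc 0 (μ E).toReal, rearrangement f s
        ≤ ∫⁻ s in Set.Ioc 0 (μ E).toReal, rearrangement g s := by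
    intro E hE hE'
    rw [← rearrPairing_charFun f hE hE', ← rearrPairing_charFun g hE hE']
    exact h E hE hE'
  intro t ht
  by_cases hex : ∃ E, MeasurableSet E ∧ μ E < ∞ ∧ t ≤ (μ E).toReal
  · obtain ⟨E, hE, hE', htE⟩ := hex
    have hg := hfin E hE hE'
    have hf := (h E hE hE').trans_lt hg
    rw [rearrPairing_charFun _ hE hE'] at hf hg
    obtain ⟨hfi, hfe⟩ := setLIntegral_antitone_eq (rearrangement_antitone f)
      ENNReal.toReal_nonneg hf
    obtain ⟨hgi, hge⟩ := setLIntegral_antitone_eq (rearrangement_antitone g)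
      ENNReal.toReal_nonneg hg
    rw [hfe t ⟨ht.le, htE⟩, hge t ⟨ht.le, htE⟩]
    refine ENNReal.ofReal_le_ofReal (integral_le_of_affine_gaps ⟨ht.le, htE⟩ hfi hgi
      {r | ∃ E, MeasurableSet E ∧ μ E < ∞ ∧ r = (μ E).toReal} ?_ ?_ ⟨E, hE, hE', rfl⟩)
    · intro a b ha0 hab
      have key : ∀ r ∈ Set.Ioo a b, ∀ s ∈ Set.Ioo a b, r ≤ s → ∀ k : R →ₘ[μ] ℝ≥0∞,
          rearrangement k r = rearrangement k s := by
        intro r hr s hs hrs k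
        refine rearrangement_eq_of_gap k hrs fun D hD hDs => ?_
        have hD' : μ D < ∞ := hDs.trans_lt ENNReal.ofReal_lt_top
        have hDs' := ENNReal.toReal_le_of_le_ofReal (ha0.trans hs.1.le) hDs
        rw [ENNReal.le_ofReal_iff_toReal_le hD'.ne (ha0.trans hr.1.le)]
        by_contra! hlt
        exact hab _ ⟨hr.1.trans hlt, hDs'.trans_lt hs.2⟩ ⟨D, hD, hD', rfl⟩
      intro r hr s hs
      rcases le_total r s with hrs | hrs
      · simp only [key r hr s hs hrs, and_self]
      · simp only [key s hs r hr hrs, and_self]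
    · rintro r ⟨E', hE1, hE2, rfl⟩ hr
      have := hF E' hE1 hE2
      rw [hfe _ hr, hge _ hr] at this
      refine (ENNReal.ofReal_le_ofReal_iff ?_).1 this
      exact intervalIntegral.integral_nonneg hr.1 fun _ _ => ENNReal.toReal_nonneg
  · push Not at hex
    -- No set of finite measure reaches `t`, so by σ-finiteness the whole space has measure at most
    -- `t`; rearrangements vanish almost everywhere beyond that measure.
    have huniv : μ Set.univ ≤ ENNReal.ofReal t := by
      rw [← iUnion_spanningSets μ, (monotone_spanningSets μ).measure_iUnion]
      refine iSup_le fun n => ?_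
      have := hex _ (measurableSet_spanningSets μ n) (measure_spanningSets_lt_top μ n)
      exact (ENNReal.le_ofReal_iff_toReal_le (measure_spanningSets_lt_top μ n).ne ht.le).2 this.le
    have hlt : μ Set.univ < ∞ := huniv.trans_lt ENNReal.ofReal_lt_top
    refine (setLIntegral_rearrangement_le_univ f hlt t).trans
      ((hF _ MeasurableSet.univ hlt).trans (lintegral_mono_set (Set.Ioc_subset_Ioc_right ?_)))
    exact ENNReal.toReal_le_of_le_ofReal ht.le huniv

/-! ### Passing between complex-valued and non-negative functions -/

lemma coeFn_modulus (f : R →ₘ[μ] ℂ) : ∀ᵐ x ∂μ, modulus f x = ‖f x‖ₑ :=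
  AEEqFun.coeFn_comp _ _ f

lemma coeFn_charFun {E : Set R} (hE : MeasurableSet E) :
    ∀ᵐ x ∂μ, charFun μ E hE x = E.indicator (fun _ => 1) x :=
  AEEqFun.coeFn_mk _ _

lemma exists_modulus_eq {g : R →ₘ[μ] ℝ≥0∞} (h : ∀ᵐ x ∂μ, g x < ∞) :
    ∃ f : R →ₘ[μ] ℂ, modulus f = g := by
  have hm : Measurable fun x => ((g x).toReal : ℂ) :=
    Complex.measurable_ofReal.comp g.measurable.ennreal_toReal
  refine ⟨AEEqFun.mk _ hm.aestronglyMeasurable, AEEqFun.ext ?_⟩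
  filter_upwards [coeFn_modulus (AEEqFun.mk _ (hm.aestronglyMeasurable (μ := μ))),
    AEEqFun.coeFn_mk _ (hm.aestronglyMeasurable (μ := μ)), h] with x h1 h2 h3
  rw [h1, h2, ← ofReal_norm, Complex.norm_real, Real.norm_eq_abs,
    abs_of_nonneg ENNReal.toReal_nonneg, ENNReal.ofReal_toReal h3.ne]

lemma eq_zero_of_modulus_eq_zero {f : R →ₘ[μ] ℂ} (h : modulus f = 0) : f = 0 := by
  apply AEEqFun.ext
  filter_upwards [coeFn_modulus f, AEEqFun.coeFn_zero (α := R) (β := ℝ≥0∞) (μ := μ),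
    AEEqFun.coeFn_zero (α := R) (β := ℂ) (μ := μ)] with x h1 h2 h3
  rw [h, h2] at h1
  rw [h3]
  simpa using h1.symm

lemma lintegral_mul_charFun (g : R →ₘ[μ] ℝ≥0∞) {E : Set R} (hE : MeasurableSet E) :
    ∫⁻ x, g x * charFun μ E hE x ∂μ = ∫⁻ x in E, g x ∂μ := by
  rw [← lintegral_indicator hE]
  refine lintegral_congr_ae ?_
  filter_upwards [coeFn_charFun hE] with x hx
  rw [hx]
  by_cases h : x ∈ E <;> simp [h]

lemma ae_of_forall_ae_restrict_spanningSets [SigmaFinite μ] {p : R → Prop}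
    (h : ∀ E, MeasurableSet E → μ E < ∞ → ∀ᵐ x ∂μ.restrict E, p x) : ∀ᵐ x ∂μ, p x := by
  have := ae_restrict_iUnion_iff (μ := μ) (spanningSets μ) p
  rw [iUnion_spanningSets, Measure.restrict_univ] at this
  exact this.2 fun n => h _ (measurableSet_spanningSets μ n) (measure_spanningSets_lt_top μ n)

lemma ae_lt_top_of_forall_setLIntegral [SigmaFinite μ] {g : R →ₘ[μ] ℝ≥0∞}
    (h : ∀ E, MeasurableSet E → μ E < ∞ → ∫⁻ x in E, g x ∂μ < ∞) : ∀ᵐ x ∂μ, g x < ∞ :=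
  ae_of_forall_ae_restrict_spanningSets fun E hE hfin =>
    ae_lt_top g.measurable (h E hE hfin).ne

/-! ### Local integrability, truncation and domination for a function norm. -/

section FunctionNorm

variable {ρ : (R →ₘ[μ] ℝ≥0∞) → ℝ≥0∞}

lemma IsQuasiBanachFunctionNorm.definite (hρ : IsQuasiBanachFunctionNorm ρ) :
    ∀ g, ρ g = 0 → g = 0 :=
  fun g => (hρ.eq_zero_iff g).1

lemma IsQuasiBanachFunctionNorm.setLIntegral_le (hρ : IsQuasiBanachFunctionNorm ρ)
    (g : R →ₘ[μ] ℝ≥0∞) {E : Set R} (hE : MeasurableSet E) (hfin : μ E < ∞) :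
    ∫⁻ x in E, g x ∂μ ≤ associate ρ g * ρ (charFun μ E hE) := by
  rw [← lintegral_mul_charFun g hE]
  exact lintegral_mul_le_associate hρ.definite g (hρ.charFun_lt_top E hE hfin)

lemma IsQuasiBanachFunctionNorm.associate_definite [SigmaFinite μ]
    (hρ : IsQuasiBanachFunctionNorm ρ) : ∀ g, associate ρ g = 0 → g = 0 := by
  intro g hg
  apply AEEqFun.ext
  have h : ∀ᵐ x ∂μ, g x = 0 := by
    refine ae_of_forall_ae_restrict_spanningSets fun E hE hfin => ?_
    have := hρ.setLIntegral_le g hE hfin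
    rw [hg, zero_mul, nonpos_iff_eq_zero, lintegral_eq_zero_iff g.measurable] at this
    exact this
  filter_upwards [h, AEEqFun.coeFn_zero (α := R) (β := ℝ≥0∞) (μ := μ)] with x h1 h2
  rw [h1, h2, Pi.zero_apply]

/-- Since `χ_E ∈ X`, elements of `X'` are locally integrable, hence finite a.e., hence moduli of
complex functions. -/
lemma IsQuasiBanachFunctionNorm.exists_modulus_eq_of_associate [SigmaFinite μ]
    (hρ : IsQuasiBanachFunctionNorm ρ) {g : R →ₘ[μ] ℝ≥0∞} (hg : associate ρ g < ∞) :
    ∃ φ ∈ associateSpace ρ, modulus φ = g := by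
  obtain ⟨φ, rfl⟩ := exists_modulus_eq (ae_lt_top_of_forall_setLIntegral fun E hE hfin =>
    (hρ.setLIntegral_le g hE hfin).trans_lt
      (ENNReal.mul_lt_top hg (hρ.charFun_lt_top E hE hfin)))
  exact ⟨φ, hg, rfl⟩

lemma HasP5.exists_modulus_eq [SigmaFinite μ] (hP5 : HasP5 ρ) {g : R →ₘ[μ] ℝ≥0∞}
    (hg : ρ g < ∞) : ∃ f : R →ₘ[μ] ℂ, modulus f = g := by
  refine RIFunctionSpace.exists_modulus_eq (ae_lt_top_of_forall_setLIntegral fun E hE hfin => ?_)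
  obtain ⟨C, hC⟩ := hP5 E hE hfin
  exact (hC g).trans_lt (ENNReal.mul_lt_top ENNReal.coe_lt_top hg)

/-- The functions `min(f, n) χ_{S_n}`, with `S_n` the spanning sets, lie in `X`; they carry
estimates known on `X` over to arbitrary `f`. -/
lemma exists_truncations [SigmaFinite μ] (hρ : IsQuasiBanachFunctionNorm ρ)
    (f : R →ₘ[μ] ℝ≥0∞) : ∃ u : ℕ → R →ₘ[μ] ℝ≥0∞, (∀ n, ρ (u n) < ∞) ∧ (∀ n, u n ≤ f) ∧
      ∀ g : R →ₘ[μ] ℝ≥0∞, ∫⁻ x, f x * g x ∂μ = ⨆ n, ∫⁻ x, u n x * g x ∂μ := by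
  have hm : ∀ n : ℕ, Measurable ((spanningSets μ n).indicator fun x => min (f x) n) := fun n =>
    (f.measurable.min measurable_const).indicator (measurableSet_spanningSets μ n)
  have hmk : ∀ n, ∀ᵐ x ∂μ, (AEEqFun.mk _ (hm n).aestronglyMeasurable : R →ₘ[μ] ℝ≥0∞) x
      = (spanningSets μ n).indicator (fun x => min (f x) n) x := fun n => AEEqFun.coeFn_mk _ _
  refine ⟨fun n => AEEqFun.mk _ (hm n).aestronglyMeasurable, fun n => ?_, fun n => ?_,
    fun g => ?_⟩
  · have hE := measurableSet_spanningSets μ n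
    refine lt_of_le_of_lt (hρ.mono _ (scale n (charFun μ _ hE)) ?_) ?_
    · rw [← AEEqFun.coeFn_le]
      filter_upwards [hmk n, coeFn_charFun hE, coeFn_scale n (charFun μ _ hE)] with x h1 h2 h3
      rw [h1, h3, h2]
      by_cases hx : x ∈ spanningSets μ n <;> simp [hx]
    · rw [hρ.smul]
      exact ENNReal.mul_lt_top ENNReal.coe_lt_top
        (hρ.charFun_lt_top _ hE (measure_spanningSets_lt_top μ n))
  · rw [← AEEqFun.coeFn_le]
    filter_upwards [hmk n] with x hx
    rw [hx]
    exact Set.indicator_le' (fun _ _ => min_le_left _ _) (fun _ _ => zero_le) x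
  · have e : ∀ n, ∫⁻ x, (AEEqFun.mk _ (hm n).aestronglyMeasurable : R →ₘ[μ] ℝ≥0∞) x * g x ∂μ
        = ∫⁻ x, (spanningSets μ n).indicator (fun x => min (f x) n) x * g x ∂μ := by
      intro n
      refine lintegral_congr_ae ?_
      filter_upwards [hmk n] with x hx
      rw [hx]
    have hmono : ∀ x, Monotone fun n : ℕ =>
        (spanningSets μ n).indicator (fun x => min (f x) n) x := by
      intro x m n hmn
      by_cases hx : x ∈ spanningSets μ m
      · simp only [Set.indicator_of_mem hx,
          Set.indicator_of_mem (monotone_spanningSets μ hmn hx)]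
        exact min_le_min_left _ (by exact_mod_cast hmn)
      · simp only [Set.indicator_of_notMem hx]
        exact zero_le
    have hmg : ∀ n : ℕ, Measurable fun x =>
        (spanningSets μ n).indicator (fun x => min (f x) n) x * g x := fun n =>
      (hm n).mul g.measurable
    simp_rw [e]
    rw [← lintegral_iSup hmg fun m n hmn x => by gcongr; exact hmono x hmn]
    refine lintegral_congr fun x => ?_
    rw [← ENNReal.iSup_mul]
    congr 1
    have hx : x ∈ ⋃ n, spanningSets μ n := by rw [iUnion_spanningSets]; trivial
    obtain ⟨N, hN⟩ := Set.mem_iUnion.1 hx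
    refine le_antisymm ?_ (iSup_le fun n =>
      Set.indicator_le' (fun _ _ => min_le_left _ _) (fun _ _ => zero_le) x)
    have h1 : f x = ⨆ n : ℕ, min (f x) n := by
      simp only [min_comm (f x)]
      rw [← iSup_inf_eq, ENNReal.iSup_natCast, top_inf_eq]
    refine h1.le.trans (iSup_le fun n => le_iSup_of_le (max n N) ?_)
    rw [Set.indicator_of_mem (monotone_spanningSets μ (le_max_right n N) hN)]
    exact min_le_min_left _ (by exact_mod_cast le_max_left n N)

/-- A function `ψ` in the associate space dominates if every `|·|_φ`, `φ ∈ X'`, is bounded on `X`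
by a multiple of `|·|_ψ`. -/
def IsDominating (ρ : (R →ₘ[μ] ℝ≥0∞) → ℝ≥0∞) (ψ : R →ₘ[μ] ℝ≥0∞) : Prop :=
  ∀ φ, associate ρ φ < ∞ → ∃ C : ℝ≥0, ∀ f, ρ f < ∞ →
    rearrPairing φ f ≤ C * rearrPairing ψ f

/-- Gliding hump: if `4^n ‖φ_n‖_{X'}` fails as a constant for every `n`, the sum of the `φ_n`,
rescaled to norm `2^{-n}`, lies in `X'` but is not dominated by `ψ`. -/
lemma IsDominating.exists_uniform (hμ : Resonant μ) (hd : ∀ g, ρ g = 0 → g = 0)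
    (hd' : ∀ g, associate ρ g = 0 → g = 0) {ψ : R →ₘ[μ] ℝ≥0∞} (hψ : IsDominating ρ ψ) :
    ∃ C : ℝ≥0, ∀ φ f, associate ρ φ < ∞ → ρ f < ∞ →
      rearrPairing φ f ≤ C * associate ρ φ * rearrPairing ψ f := by
  by_contra! hcon
  choose φ f hφ hf hlt using fun n : ℕ => hcon ((4 : ℝ≥0) ^ n)
  have hpos : ∀ n, associate ρ (φ n) ≠ 0 := by
    intro n h0
    have := hlt n
    rw [hd' _ h0, rearrPairing_zero_left] at this
    exact absurd this not_lt_zero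
  set c : ℕ → ℝ≥0 := fun n => 2⁻¹ ^ n * ((associate ρ (φ n)).toNNReal)⁻¹ with hc
  have hcn : ∀ n, (c n : ℝ≥0∞) * associate ρ (φ n) = 2⁻¹ ^ n := by
    intro n
    have h0 : (associate ρ (φ n)).toNNReal ≠ 0 := ENNReal.toNNReal_ne_zero.2 ⟨hpos n, (hφ n).ne⟩
    rw [hc, ENNReal.coe_mul, ENNReal.coe_inv h0, ENNReal.coe_toNNReal (hφ n).ne, mul_assoc,
      ENNReal.inv_mul_cancel (hpos n) (hφ n).ne]
    simp [ENNReal.inv_pow]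
  obtain ⟨θ, hθ, hle⟩ := exists_associate_lt_top_of_tsum hd φ c (by
    simp_rw [hcn]
    rw [ENNReal.tsum_geometric]
    simp)
  obtain ⟨C, hC⟩ := hψ θ hθ
  obtain ⟨n, hn⟩ := pow_unbounded_of_one_lt C (one_lt_two : (1 : ℝ≥0) < 2)
  have h1 : (c n : ℝ≥0∞) * rearrPairing (φ n) (f n) ≤ C * rearrPairing ψ (f n) := by
    rw [← hμ.rearrPairing_scale_left]
    exact (hμ.rearrPairing_mono_left (hle n) _).trans (hC _ (hf n))
  have hc0 : (c n : ℝ≥0∞) ≠ 0 := by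
    intro h0
    have := hcn n
    rw [h0, zero_mul] at this
    exact absurd this.symm (pow_ne_zero _ (by simp))
  have h2 : (c n : ℝ≥0∞) * (((4 : ℝ≥0) ^ n : ℝ≥0) * associate ρ (φ n) * rearrPairing ψ (f n))
      = ((2 : ℝ≥0) ^ n : ℝ≥0) * rearrPairing ψ (f n) := by
    have h4 : ((4 : ℝ≥0) ^ n : ℝ≥0) = (2 : ℝ≥0) ^ n * 2 ^ n := by
      rw [← mul_pow]; norm_num
    have h5 : (2⁻¹ : ℝ≥0∞) ^ n * 2 ^ n = 1 := by
      rw [← mul_pow, ENNReal.inv_mul_cancel two_ne_zero (by simp), one_pow]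
    calc _ = ((c n : ℝ≥0∞) * associate ρ (φ n)) * ((4 : ℝ≥0) ^ n : ℝ≥0)
          * rearrPairing ψ (f n) := by ring
      _ = _ := by
        rw [hcn, h4]
        push_cast
        rw [← mul_assoc, h5, one_mul]
  -- The failing inequality scaled by `c n` reads `2^n |f_n|_ψ < c_n |f_n|_{φ_n}`, whereas the right
  -- side is at most `C |f_n|_ψ` and `C < 2^n`.
  have h3 := (ENNReal.mul_lt_mul_iff_right hc0 ENNReal.coe_ne_top).2 (hlt n)
  rw [h2] at h3
  refine absurd (h3.trans_le h1) (not_lt.2 ?_)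
  gcongr

lemma IsDominating.associate_associate_le [SigmaFinite μ] (hμ : Resonant μ)
    (hρ : IsQuasiBanachFunctionNorm ρ) {ψ : R →ₘ[μ] ℝ≥0∞} (hψ : IsDominating ρ ψ) :
    ∃ C : ℝ≥0, ∀ f, associate (associate ρ) f ≤ C * rearrPairing ψ f := by
  obtain ⟨C, hC⟩ := hψ.exists_uniform hμ hρ.definite hρ.associate_definite
  refine ⟨C, fun f => (associate_le_iff hρ.associate_definite).2 fun g hg => ?_⟩
  obtain ⟨u, hu, hle, hsup⟩ := exists_truncations hρ f
  rw [hsup]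
  refine iSup_le fun n => (hμ.lintegral_mul_le _ _).trans ?_
  rw [rearrPairing_comm]
  refine (hC g (u n) hg (hu n)).trans ?_
  rw [mul_right_comm]
  gcongr
  exact hμ.rearrPairing_mono_right ψ (hle n)

end FunctionNorm

/-! ### The topology `ξ` -/

section Topology

variable {ρ : (R →ₘ[μ] ℝ≥0∞) → ℝ≥0∞}

lemma phiNorm_add_le (hμ : Resonant μ) (φ f g : R →ₘ[μ] ℂ) :
    phiNorm φ (f + g) ≤ phiNorm φ f + phiNorm φ g := by
  simp only [phiNorm, rearrPairing_comm (modulus φ)]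
  exact (hμ.rearrPairing_mono_left (modulus_add_le f g) _).trans (hμ.rearrPairing_add_le _ _ _)

lemma phiNorm_smul (hμ : Resonant μ) (φ : R →ₘ[μ] ℂ) (c : ℂ) (f : R →ₘ[μ] ℂ) :
    phiNorm φ (c • f) = ‖c‖₊ * phiNorm φ f := by
  rw [phiNorm, modulus_smul, hμ.rearrPairing_scale_right, phiNorm]

lemma phiNorm_zero (φ : R →ₘ[μ] ℂ) : phiNorm φ 0 = 0 := by
  rw [phiNorm, modulus_zero, rearrPairing_zero_right]

lemma phiNorm_lt_top (hμ : Resonant μ) (hρ : IsQuasiBanachFunctionNorm ρ)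
    (hri : IsRearrangementInvariant ρ) {φ : R →ₘ[μ] ℂ} (hφ : φ ∈ associateSpace ρ)
    (f : functionSpace hρ) : phiNorm φ f < ∞ :=
  (rearrPairing_le_associate hμ hρ.definite hri _ f.2).trans_lt (ENNReal.mul_lt_top hφ f.2)

/-- The family of seminorms is directed, via `|φ₁| + |φ₂| ∈ X'`; hence single balls, not finite
intersections, form a neighbourhood base. -/
lemma exists_phiNorm_dominating [SigmaFinite μ] (hμ : Resonant μ)
    (hρ : IsQuasiBanachFunctionNorm ρ) {φ₁ φ₂ : R →ₘ[μ] ℂ} (h₁ : φ₁ ∈ associateSpace ρ)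
    (h₂ : φ₂ ∈ associateSpace ρ) :
    ∃ φ ∈ associateSpace ρ, ∀ f, phiNorm φ₁ f ≤ phiNorm φ f ∧ phiNorm φ₂ f ≤ phiNorm φ f := by
  have hlt : associate ρ (modulus φ₁ + modulus φ₂) < ∞ :=
    (associate_add_le hρ.definite _ _).trans_lt (ENNReal.add_lt_top.2 ⟨h₁, h₂⟩)
  obtain ⟨φ, hφ, he⟩ := hρ.exists_modulus_eq_of_associate hlt
  refine ⟨φ, hφ, fun f => ?_⟩
  rw [phiNorm, phiNorm, phiNorm, he]
  have hadd := AEEqFun.coeFn_add (modulus φ₁) (modulus φ₂)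
  constructor
  · refine hμ.rearrPairing_mono_left (AEEqFun.coeFn_le.1 ?_) _
    filter_upwards [hadd] with x hx
    rw [hx]
    exact le_self_add
  · refine hμ.rearrPairing_mono_left (AEEqFun.coeFn_le.1 ?_) _
    filter_upwards [hadd] with x hx
    rw [hx]
    exact le_add_self

lemma coe_functionSpace_sub {hρ : IsQuasiBanachFunctionNorm ρ} (f g : functionSpace hρ) :
    ((f - g : functionSpace hρ) : R →ₘ[μ] ℂ) = f - g := rfl

lemma mem_nhds_xiTopology_iff [SigmaFinite μ] (hμ : Resonant μ)
    (hρ : IsQuasiBanachFunctionNorm ρ) (f₀ : functionSpace hρ) (s : Set (functionSpace hρ)) :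
    s ∈ @nhds _ (xiTopology hρ) f₀ ↔ ∃ φ ∈ associateSpace ρ, ∃ ε : ℝ≥0, 0 < ε ∧
      {f : functionSpace hρ | phiNorm φ ((f - f₀ : functionSpace hρ) : R →ₘ[μ] ℂ) < ε} ⊆ s := by
  let _ := xiTopology hρ
  rw [mem_nhds_iff]
  constructor
  · rintro ⟨U, hUs, hU, hf₀⟩
    have key : ∀ g ∈ U, ∃ φ ∈ associateSpace ρ, ∃ ε : ℝ≥0, 0 < ε ∧
        {f : functionSpace hρ | phiNorm φ ((f - g : functionSpace hρ) : R →ₘ[μ] ℂ) < ε} ⊆ U := by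
      clear hf₀ hUs
      induction hU with
      | basic u hu =>
        obtain ⟨φ, hφ, f₁, ε, hε, rfl⟩ := hu
        intro g hg
        have hg' : phiNorm φ ((g - f₁ : functionSpace hρ) : R →ₘ[μ] ℂ) < ε := hg
        obtain ⟨r, hr⟩ := ENNReal.canLift.prf _ (hg'.trans ENNReal.coe_lt_top).ne
        rw [← hr, ENNReal.coe_lt_coe] at hg'
        refine ⟨φ, hφ, ε - r, tsub_pos_of_lt hg', fun f hf => ?_⟩
        have hf' : phiNorm φ ((f - g : functionSpace hρ) : R →ₘ[μ] ℂ) < (ε - r : ℝ≥0) := hf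
        change phiNorm φ ((f - f₁ : functionSpace hρ) : R →ₘ[μ] ℂ) < ε
        have e : ((f - f₁ : functionSpace hρ) : R →ₘ[μ] ℂ)
            = (f - g : functionSpace hρ) + (g - f₁ : functionSpace hρ) := by
          push_cast
          abel
        rw [e]
        refine (phiNorm_add_le hμ _ _ _).trans_lt ?_
        rw [← hr]
        refine (ENNReal.add_lt_add_right ENNReal.coe_ne_top hf').trans_le ?_
        rw [← ENNReal.coe_add, tsub_add_cancel_of_le hg'.le]
      | univ =>
        intro g _
        refine ⟨0, ?_, 1, one_pos, Set.subset_univ _⟩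
        change associate ρ (modulus 0) < ∞
        rw [modulus_zero, associate_zero hρ.definite]
        exact ENNReal.zero_lt_top
      | inter u v _ _ ihu ihv =>
        intro g hg
        obtain ⟨φ₁, h₁, ε₁, hε₁, hs₁⟩ := ihu g hg.1
        obtain ⟨φ₂, h₂, ε₂, hε₂, hs₂⟩ := ihv g hg.2
        obtain ⟨φ, hφ, hle⟩ := exists_phiNorm_dominating hμ hρ h₁ h₂
        refine ⟨φ, hφ, min ε₁ ε₂, lt_min hε₁ hε₂, fun f hf => ⟨hs₁ ?_, hs₂ ?_⟩⟩
        · exact ((hle _).1.trans_lt hf).trans_le (by exact_mod_cast min_le_left _ _)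
        · exact ((hle _).2.trans_lt hf).trans_le (by exact_mod_cast min_le_right _ _)
      | sUnion S _ ih =>
        rintro g ⟨u, hu, hg⟩
        obtain ⟨φ, hφ, ε, hε, hs⟩ := ih u hu g hg
        exact ⟨φ, hφ, ε, hε, hs.trans (Set.subset_sUnion_of_mem hu)⟩
    obtain ⟨φ, hφ, ε, hε, hs⟩ := key f₀ hf₀
    exact ⟨φ, hφ, ε, hε, hs.trans hUs⟩
  · rintro ⟨φ, hφ, ε, hε, hs⟩
    refine ⟨_, hs, TopologicalSpace.isOpen_generateFrom_of_mem ⟨φ, hφ, f₀, ε, hε, rfl⟩, ?_⟩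
    change phiNorm φ ((f₀ - f₀ : functionSpace hρ) : R →ₘ[μ] ℂ) < ε
    rw [coe_functionSpace_sub, sub_self, phiNorm_zero]
    exact_mod_cast hε

lemma metrizableSpace_of_isNormable {E : Type*} [AddCommGroup E] [Module ℂ E]
    {τ : TopologicalSpace E} (h : IsNormable τ) : @TopologicalSpace.MetrizableSpace E τ := by
  obtain ⟨p, hp, hbasis⟩ := h
  let N : AddGroupNorm E :=
    { toFun := p
      map_zero' := map_zero p
      add_le' := map_add_le_add p
      neg' := map_neg_eq_map p
      eq_zero_of_map_eq_zero' := hp }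
  let _ : NormedAddCommGroup E := N.toNormedAddCommGroup
  have e : τ = (UniformSpace.toTopologicalSpace : TopologicalSpace E) := by
    refine TopologicalSpace.ext_nhds fun x => ?_
    refine (hbasis x).eq_of_same_basis ?_
    convert (Metric.nhds_basis_ball (x := x)) using 1
    funext ε
    ext y
    rw [Metric.mem_ball, dist_eq_norm]
    rfl
  rw [e]
  infer_instance

lemma exists_isDominating_of_firstCountable [SigmaFinite μ] (hμ : Resonant μ)
    (hρ : IsQuasiBanachFunctionNorm ρ) (hri : IsRearrangementInvariant ρ) (hP5 : HasP5 ρ)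
    (h : @FirstCountableTopology _ (xiTopology hρ)) :
    ∃ ψ, associate ρ ψ < ∞ ∧ IsDominating ρ ψ := by
  let _ := xiTopology hρ
  obtain ⟨U, hU⟩ := (𝓝 (0 : functionSpace hρ)).exists_antitone_basis
  choose φ hφ ε hε hsub using fun n => (mem_nhds_xiTopology_iff hμ hρ 0 (U n)).1 (hU.mem n)
  -- Positive weights making `∑ c_n ‖φ_n‖_{X'}` converge, so that `ψ ≥ c_n |φ_n|` for all `n` is
  -- possible inside `X'`.
  obtain ⟨c, hc, hsum⟩ := ENNReal.exists_pos_tsum_mul_lt_of_countable one_ne_zero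
    (fun n => associate ρ (modulus (φ n))) fun n => (hφ n).ne
  obtain ⟨ψ, hψ, hle⟩ := exists_associate_lt_top_of_tsum hρ.definite (fun n => modulus (φ n)) c (by
    simp only [mul_comm (c _ : ℝ≥0∞)]
    exact hsum.trans ENNReal.one_lt_top)
  refine ⟨ψ, hψ, fun θ hθ => ?_⟩
  obtain ⟨θ, hθ, rfl⟩ := hρ.exists_modulus_eq_of_associate hθ
  obtain ⟨n, -, hn⟩ := hU.1.mem_iff.1
    ((mem_nhds_xiTopology_iff hμ hρ 0 _).2 ⟨θ, hθ, 1, one_pos, subset_rfl⟩)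
  -- The unit ball of `|·|_θ` contains the `φ n`-ball of radius `ε n`, which gives `(ε n)⁻¹` by
  -- homogeneity; `c_n |φ_n| ≤ ψ` gives `(c n)⁻¹`.
  refine ⟨(ε n)⁻¹ * (c n)⁻¹, fun f hf => ?_⟩
  obtain ⟨g, rfl⟩ := hP5.exists_modulus_eq hf
  set f : functionSpace hρ := ⟨g, hf⟩
  have h1 : ∀ a : ℝ≥0, a * phiNorm (φ n) g < ε n → a * phiNorm θ g < 1 := by
    intro a ha
    have e : ∀ χ, phiNorm χ (((a : ℂ) • f - 0 : functionSpace hρ) : R →ₘ[μ] ℂ)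
        = a * phiNorm χ g := by
      intro χ
      rw [coe_functionSpace_sub, Submodule.coe_zero, sub_zero, Submodule.coe_smul, phiNorm_smul hμ]
      congr 2
      ext
      simp
    have := hn (hsub n (show phiNorm (φ n) (((a : ℂ) • f - 0 : functionSpace hρ) : R →ₘ[μ] ℂ)
      < ε n by rwa [e]))
    have h' : phiNorm θ (((a : ℂ) • f - 0 : functionSpace hρ) : R →ₘ[μ] ℂ) < (1 : ℝ≥0) := this
    rw [e] at h'
    simpa using h'
  have h2 : phiNorm θ g ≤ (ε n : ℝ≥0∞)⁻¹ * phiNorm (φ n) g := by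
    obtain ⟨q, hq⟩ := ENNReal.canLift.prf _ (phiNorm_lt_top hμ hρ hri hθ f).ne
    obtain ⟨p, hp⟩ := ENNReal.canLift.prf _ (phiNorm_lt_top hμ hρ hri (hφ n) f).ne
    change (q : ℝ≥0∞) = phiNorm θ g at hq
    change (p : ℝ≥0∞) = phiNorm (φ n) g at hp
    rw [← hq, ← hp] at h1 ⊢
    rw [← ENNReal.coe_inv (hε n).ne']
    norm_cast at h1 ⊢
    by_contra! hlt
    have hq0 : 0 < q := lt_of_le_of_lt zero_le hlt
    -- Rescaling to `|·|_θ = 1` puts the function in the `φ n`-ball but not in the open unit ball of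
    -- `|·|_θ`.
    have := h1 q⁻¹ (by
      rw [inv_mul_lt_iff₀ (hε n)] at hlt
      rw [inv_mul_lt_iff₀ hq0, mul_comm]
      exact hlt)
    rw [inv_mul_cancel₀ hq0.ne'] at this
    exact lt_irrefl _ this
  have h3 : (c n : ℝ≥0∞) * phiNorm (φ n) g ≤ rearrPairing ψ (modulus g) := by
    rw [phiNorm, ← hμ.rearrPairing_scale_left]
    exact hμ.rearrPairing_mono_left (hle n) _
  rw [ENNReal.coe_mul, ENNReal.coe_inv (hε n).ne', ENNReal.coe_inv (hc n).ne', mul_assoc]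
  refine h2.trans (mul_le_mul_right ?_ _)
  calc phiNorm (φ n) g = (c n : ℝ≥0∞)⁻¹ * (c n * phiNorm (φ n) g) := by
        rw [← mul_assoc, ENNReal.inv_mul_cancel (by exact_mod_cast (hc n).ne')
          ENNReal.coe_ne_top, one_mul]
    _ ≤ _ := by gcongr

/-- The equivalence `|·|_ψ ≈ ‖·‖_{X''}` yields normability. -/
lemma isNormable_xiTopology [SigmaFinite μ] (hμ : Resonant μ)
    (hρ : IsQuasiBanachFunctionNorm ρ) (hri : IsRearrangementInvariant ρ) (hP5 : HasP5 ρ)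
    {ψ : R →ₘ[μ] ℂ} (hψ : ψ ∈ associateSpace ρ) {C : ℝ≥0}
    (hC : ∀ f : R →ₘ[μ] ℂ, associate (associate ρ) (modulus f) ≤ C * phiNorm ψ f) :
    IsNormable (xiTopology hρ) := by
  have hfin : ∀ f : functionSpace hρ, phiNorm ψ f ≠ ∞ := fun f =>
    (phiNorm_lt_top hμ hρ hri hψ f).ne
  let p : Seminorm ℂ (functionSpace hρ) := Seminorm.of
    (fun f => (phiNorm ψ (f : R →ₘ[μ] ℂ)).toReal)
    (fun f g => by
      rw [← ENNReal.toReal_add (hfin f) (hfin g)]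
      exact ENNReal.toReal_mono (ENNReal.add_ne_top.2 ⟨hfin f, hfin g⟩) (phiNorm_add_le hμ _ _ _))
    (fun a f => by
      rw [Submodule.coe_smul, phiNorm_smul hμ, ENNReal.toReal_mul]
      rfl)
  have hp : ∀ f : functionSpace hρ, p f = (phiNorm ψ (f : R →ₘ[μ] ℂ)).toReal := fun _ => rfl
  refine ⟨p, fun f hf => ?_, fun f₀ => ⟨fun s => ?_⟩⟩
  · have h0 : phiNorm ψ (f : R →ₘ[μ] ℂ) = 0 := by
      rw [hp, ENNReal.toReal_eq_zero_iff] at hf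
      exact hf.resolve_right (hfin f)
    have h1 := hC f
    rw [h0, mul_zero] at h1
    refine Subtype.ext (eq_zero_of_modulus_eq_zero (AEEqFun.ext ?_))
    have h2 : ∀ᵐ x ∂μ, modulus (f : R →ₘ[μ] ℂ) x = 0 := by
      refine ae_of_forall_ae_restrict_spanningSets fun E hE hE' => ?_
      obtain ⟨D, hD⟩ := hP5 E hE hE'
      -- (P5) says exactly that `χ_E ∈ X'`, so `‖f‖_{X''} = 0` forces `∫_E |f| = 0`.
      have hχ : associate ρ (charFun μ E hE) ≤ D := by
        refine (associate_le_iff hρ.definite).2 fun g _ => ?_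
        simp only [mul_comm _ (g _)]
        rw [lintegral_mul_charFun]
        exact hD g
      have := lintegral_mul_le_associate hρ.associate_definite (modulus (f : R →ₘ[μ] ℂ))
        (hχ.trans_lt ENNReal.coe_lt_top)
      rw [nonpos_iff_eq_zero.1 h1, zero_mul, nonpos_iff_eq_zero, lintegral_mul_charFun,
        lintegral_eq_zero_iff (modulus (f : R →ₘ[μ] ℂ)).measurable] at this
      exact this
    filter_upwards [h2, AEEqFun.coeFn_zero (α := R) (β := ℝ≥0∞) (μ := μ)] with x h3 h4
    rw [h3, h4, Pi.zero_apply]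
  · rw [mem_nhds_xiTopology_iff hμ hρ]
    constructor
    · rintro ⟨φ, hφ, ε, hε, hs⟩
      -- `|f|_φ ≤ ‖φ‖_{X'} ‖f‖_{X''} ≤ K |f|_ψ`; the radius uses `K + 1` because `K` may be zero.
      set K : ℝ≥0 := (associate ρ (modulus φ)).toNNReal * C
      refine ⟨ε / (K + 1), by positivity, fun f hf => hs ?_⟩
      have hf' : (phiNorm ψ ((f - f₀ : functionSpace hρ) : R →ₘ[μ] ℂ)).toReal
        < ε / (K + 1) := hf
      change phiNorm φ ((f - f₀ : functionSpace hρ) : R →ₘ[μ] ℂ) < ε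
      obtain ⟨q, hq⟩ := ENNReal.canLift.prf _ (hfin (f - f₀))
      have hle : phiNorm φ ((f - f₀ : functionSpace hρ) : R →ₘ[μ] ℂ) ≤ K * q := by
        rw [phiNorm, rearrPairing_comm]
        refine (rearrPairing_le_associate hμ hρ.associate_definite
          (isRearrangementInvariant_associate hμ hρ.definite hri) _ hφ).trans ?_
        rw [ENNReal.coe_mul, ENNReal.coe_toNNReal (ne_of_lt hφ), hq, mul_assoc, mul_comm]
        gcongr
        exact hC _
      refine hle.trans_lt ?_
      rw [← hq, ENNReal.coe_toReal, lt_div_iff₀ (by positivity)] at hf'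
      norm_cast at hf' ⊢
      refine lt_of_le_of_lt ?_ hf'
      rw [mul_comm]
      gcongr
      exact le_self_add
    · rintro ⟨ε, hε, hs⟩
      refine ⟨ψ, hψ, ⟨ε, hε.le⟩, hε, fun f hf => hs ?_⟩
      change (phiNorm ψ ((f - f₀ : functionSpace hρ) : R →ₘ[μ] ℂ)).toReal < ε
      have := (ENNReal.toReal_lt_toReal (hfin (f - f₀)) ENNReal.coe_ne_top).2 hf
      exact this

end Topology

end RIFunctionSpace

/-! ### The equivalence of the five statements. -/

theorem mainTheorem11 {R : Type*} [MeasurableSpace R] (μ : Measure R) [SigmaFinite μ]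
    (hμ : RIFunctionSpace.Resonant μ)
    (ρ : (R →ₘ[μ] ℝ≥0∞) → ℝ≥0∞)
    (hρ : RIFunctionSpace.IsQuasiBanachFunctionNorm ρ)
    (hri : RIFunctionSpace.IsRearrangementInvariant ρ)
    (hP5 : RIFunctionSpace.HasP5 ρ) :
    List.TFAE [
      @FirstCountableTopology _ (RIFunctionSpace.xiTopology hρ),
      @TopologicalSpace.MetrizableSpace _ (RIFunctionSpace.xiTopology hρ),
      RIFunctionSpace.IsNormable (RIFunctionSpace.xiTopology hρ),
      ∃ ψ ∈ RIFunctionSpace.associateSpace ρ, ∃ C : ℝ≥0, 0 < C ∧ ∀ f : R →ₘ[μ] ℂ,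
        RIFunctionSpace.phiNorm ψ f ≤
          C * RIFunctionSpace.associate (RIFunctionSpace.associate ρ) (RIFunctionSpace.modulus f) ∧
        RIFunctionSpace.associate (RIFunctionSpace.associate ρ) (RIFunctionSpace.modulus f) ≤
          C * RIFunctionSpace.phiNorm ψ f,
      ∃ ψ ∈ RIFunctionSpace.associateSpace ρ, ∀ φ : R →ₘ[μ] ℂ,
        φ ∈ RIFunctionSpace.associateSpace ρ ↔
          ∃ C : ℝ, RIFunctionSpace.HLP (RIFunctionSpace.modulus φ)
            (RIFunctionSpace.modulus ((C : ℂ) • ψ))] := by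
  open RIFunctionSpace in
  have hri' := isRearrangementInvariant_associate hμ hρ.definite hri
  have le_bidual : ∀ φ f : R →ₘ[μ] ℂ, φ ∈ associateSpace ρ →
      phiNorm φ f ≤ associate ρ (modulus φ) * associate (associate ρ) (modulus f) := by
    intro φ f hφ
    rw [phiNorm, rearrPairing_comm, mul_comm]
    exact rearrPairing_le_associate hμ hρ.associate_definite hri' _ hφ
  have four_of_dominating : (∃ ψ, associate ρ ψ < ∞ ∧ IsDominating ρ ψ) →
      ∃ ψ ∈ associateSpace ρ, ∃ C : ℝ≥0, 0 < C ∧ ∀ f : R →ₘ[μ] ℂ,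
        phiNorm ψ f ≤ C * associate (associate ρ) (modulus f) ∧
        associate (associate ρ) (modulus f) ≤ C * phiNorm ψ f := by
    rintro ⟨ψ, hψ, hdom⟩
    obtain ⟨C, hC⟩ := hdom.associate_associate_le hμ hρ
    obtain ⟨ψ, hψ, rfl⟩ := hρ.exists_modulus_eq_of_associate hψ
    -- One constant for both bounds: `‖ψ‖_{X'}` from Hölder, `C` from domination, and `1` for
    -- positivity.
    refine ⟨ψ, hψ, C + (associate ρ (modulus ψ)).toNNReal + 1, by positivity, fun f => ⟨?_, ?_⟩⟩
    · refine (le_bidual ψ f hψ).trans ?_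
      gcongr
      rw [ENNReal.coe_add, ENNReal.coe_add, ENNReal.coe_toNNReal (ne_of_lt hψ)]
      exact le_add_self.trans le_self_add
    · refine (hC (modulus f)).trans ?_
      rw [phiNorm]
      gcongr
      rw [add_assoc]
      exact le_self_add
  tfae_have 3 → 2 := metrizableSpace_of_isNormable
  tfae_have 2 → 1 := by
    intro h
    let _ := xiTopology hρ
    infer_instance
  tfae_have 1 → 4 := fun h =>
    four_of_dominating (exists_isDominating_of_firstCountable hμ hρ hri hP5 h)
  tfae_have 4 → 3 := by
    rintro ⟨ψ, hψ, C, -, hC⟩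
    exact isNormable_xiTopology hμ hρ hri hP5 hψ fun f => (hC f).2
  -- Hardy's lemma turns `φ ≺ Cψ` into `|·|_φ ≤ |C| |·|_ψ`, which is domination.
  tfae_have 5 → 4 := by
    rintro ⟨ψ, hψ, h⟩
    refine four_of_dominating ⟨modulus ψ, hψ, fun φ hφ => ?_⟩
    obtain ⟨φ, hφ, rfl⟩ := hρ.exists_modulus_eq_of_associate hφ
    obtain ⟨C, hC⟩ := (h φ).1 hφ
    refine ⟨‖(C : ℂ)‖₊, fun f _ => ?_⟩
    rw [← hμ.rearrPairing_scale_left, ← modulus_smul]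
    exact hC.rearrPairing_le f
  tfae_have 4 → 5 := by
    rintro ⟨ψ, hψ, C, -, hC⟩
    refine ⟨ψ, hψ, fun φ => ⟨fun hφ => ?_, ?_⟩⟩
    -- Hölder and statement 4 give `|χ_E|_φ ≤ ‖φ‖_{X'} ‖χ_E‖_{X''} ≤ K |χ_E|_ψ` for all `E` of
    -- finite measure.
    · set K : ℝ≥0 := (associate ρ (modulus φ)).toNNReal * C with hK
      have hnn : ‖((K : ℝ) : ℂ)‖₊ = K := by
        ext
        simp
      refine ⟨K, HLP_of_rearrPairing_charFun_le (fun E hE hfin => ?_) fun E hE hfin => ?_⟩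
      · rw [modulus_smul, hμ.rearrPairing_scale_left]
        have hχ := hρ.charFun_lt_top E hE hfin
        exact ENNReal.mul_lt_top ENNReal.coe_lt_top
          ((rearrPairing_le_associate hμ hρ.definite hri _ hχ).trans_lt (ENNReal.mul_lt_top hψ hχ))
      · obtain ⟨χ, hχ⟩ := hP5.exists_modulus_eq (hρ.charFun_lt_top E hE hfin)
        rw [modulus_smul, hμ.rearrPairing_scale_left, hnn, ← hχ]
        refine (le_bidual φ χ hφ).trans ?_
        rw [hK, ENNReal.coe_mul, ENNReal.coe_toNNReal (ne_of_lt hφ), mul_assoc]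
        gcongr
        exact (hC χ).2
    · rintro ⟨D, hD⟩
      refine (associate_le_of_rearrPairing_le hμ hρ.definite
        (c := ‖(D : ℂ)‖₊ * associate ρ (modulus ψ)) fun g hg => ?_).trans_lt
        (ENNReal.mul_lt_top ENNReal.coe_lt_top hψ)
      refine (hD.rearrPairing_le g).trans ?_
      rw [modulus_smul, hμ.rearrPairing_scale_left, mul_assoc]
      gcongr
      exact rearrPairing_le_associate hμ hρ.definite hri _ hg
  tfae_finish
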